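/- Let $q\in\mathbb C$ with $0<|q|<1$. For $x\in\mathbb C$ put $(x;q)_\infty=\prod_{n\ge 0}(1-xq^n)$, and for $n\in\mathbb Z$ let $(x;q)_n=(x;q)_\infty/(q^nx;q)_\infty$, i.e. $(x;q)_n=\prod_{k=0}^{n-1}(1-xq^k)$ and $(x;q)_{-n}=\prod_{k=1}^{n}(1-xq^{-k})^{-1}$ for $n\ge 0$; write $(x_1,\dots,x_m;q)_n=(x_1;q)_n\cdots(x_m;q)_n$, also for $n=\infty$. For $x\ne 0$ put $$\theta(x)=\frac1{(q;q)_\infty}\sum_{n=-\infty}^{\infty}(-1)^nq^{n(n-1)/2}x^n,\qquad \theta(x_1,\dots,x_m)=\theta(x_1)\cdots\theta(x_m),$$ $$\Omega(x_1,\dots,x_n;a_1,\dots,a_m)=\prod_{i=1}^n\prod_{j=1}^m(x_i/a_j;q)_\infty .$$ The very-well-poised bilateral series is $${}_8\psi_8[a;a_3,\dots,a_8;q,w]=\sum_{n=-\infty}^{\infty}\frac{(a_1,a_2,a_3,\dots,a_8;q)_n}{(aq/a_1,aq/a_2,aq/a_3,\dots,aq/a_8;q)_n}\,w^n,\qquad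 a_1=q\sqrt a,\ a_2=-q\sqrt a .$$ Let $a,b,c,d,e,z$ be nonzero complex numbers with $a=de$, $bc=zq$ and $|aq/z|<1$. Assume that no denominator below vanishes, namely: $a\ne q^{2k}$ for all $k\in\mathbb Z$; for each $x\in\{b,c,d,e,a/z,z\}$ and each integer $k\ge 0$, $x\ne q^{k+1}$ and $aq^{k+1}\ne x$; and $dq^k\ne z$, $eq^k\ne z$ for all integers $k\ge 0$. Then the series ${}_8\psi_8[a;b,c,d,e,a/z,z;q,aq/z]$ converges absolutely, and $${}_8\psi_8[a;b,c,d,e,a/z,z;q,aq/z]=\frac{(q,q,aq,q/a,aq/(dz),aq/(ez);q)_\infty\,\Delta}{(q/z,zq/a;q)_\infty\,\Omega(1/z;1/b,1/c,1/d,1/e)\,\Omega(aq;b,c,d,e)},$$ where $$\Delta=\frac{\theta(d,e)\,(b,c,aq/(bz),aq/(cz);q)_\infty-\theta(z,a/z)\,(aq/(bd),aq/(be),aq/(cd),aq/(ce);q)_\infty}{z\,(q/d,q/e,zq,aq/z;q)_\infty}.$$ -/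

import Mathlib

noncomputable section

namespace QSeries

/-- The infinite `q`-shifted factorial `(x; q)_∞ = ∏_{n ≥ 0} (1 - x q ^ n)`. -/
def qInf (q x : ℂ) : ℂ := ∏' n : ℕ, (1 - x * q ^ n)

/-- The multi-parameter infinite factorial `(x₁, …, x_m; q)_∞`. -/
def qInfs (q : ℂ) (xs : List ℂ) : ℂ := (xs.map (qInf q)).prod

/-- The `q`-shifted factorial `(x; q)_n` for an integer `n`:
`(x; q)_n = (1 - x) (1 - x q) ⋯ (1 - x q ^ (n - 1))` and
`(x; q)_{-n} = 1 / ((1 - x / q) (1 - x / q ^ 2) ⋯ (1 - x / q ^ n))` for `n ≥ 0`.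
It is `(x; q)_∞ / (q ^ n x; q)_∞` whenever the denominator does not vanish,
see `qPoch_eq_div`. -/
def qPoch (q x : ℂ) : ℤ → ℂ
  | Int.ofNat n => ∏ k ∈ Finset.range n, (1 - x * q ^ k)
  | Int.negSucc n => (∏ k ∈ Finset.range (n + 1), (1 - x / q ^ (k + 1)))⁻¹

/-- The multi-parameter factorial `(x₁, …, x_m; q)_n` for an integer `n`. -/
def qPochs (q : ℂ) (xs : List ℂ) (n : ℤ) : ℂ := (xs.map fun x => qPoch q x n).prod

/-- The Jacobi theta function
`θ(x) = (q; q)_∞⁻¹ ∑_{n ∈ ℤ} (-1) ^ n q ^ (n (n - 1) / 2) x ^ n`. -/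
def theta (q x : ℂ) : ℂ :=
  (∑' n : ℤ, (-1) ^ n * q ^ (n * (n - 1) / 2) * x ^ n) / qInf q q

/-- The multi-parameter theta function `θ(x₁, …, x_m) = θ(x₁) ⋯ θ(x_m)`. -/
def thetas (q : ℂ) (xs : List ℂ) : ℂ := (xs.map (theta q)).prod

/-- `Ω(x₁, …, x_n; a₁, …, a_m) = ∏_i ∏_j (x_i / a_j; q)_∞`. -/
def Omega (q : ℂ) (xs as : List ℂ) : ℂ :=
  (xs.map fun x => (as.map fun a => qInf q (x / a)).prod).prod

/-- The `n`-th term of the bilateral series `ᵣψᵣ[as; bs; q, z]`. -/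
def psiTerm (q : ℂ) (as bs : List ℂ) (z : ℂ) (n : ℤ) : ℂ :=
  qPochs q as n / qPochs q bs n * z ^ n

/-- The upper parameters `q √a, -q √a, a₃, …, aᵣ` of a very-well-poised series. -/
def vwpUpper (q a : ℂ) (as : List ℂ) : List ℂ :=
  q * a ^ (1 / 2 : ℂ) :: -(q * a ^ (1 / 2 : ℂ)) :: as

/-- The `n`-th term of the very-well-poised series `ᵣψᵣ[a; a₃, …, aᵣ; q, z]`: the lower
parameter under the upper parameter `x` is `a q / x`. -/
def vwpPsiTerm (q a : ℂ) (as : List ℂ) (z : ℂ) (n : ℤ) : ℂ :=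
  psiTerm q (vwpUpper q a as) ((vwpUpper q a as).map fun x => a * q / x) z n

/-- The very-well-poised bilateral series `ᵣψᵣ[a; a₃, …, aᵣ; q, z]`. -/
def vwpPsi (q a : ℂ) (as : List ℂ) (z : ℂ) : ℂ := ∑' n : ℤ, vwpPsiTerm q a as z n

theorem qInf_eq_mul {q : ℂ} (hq : ‖q‖ < 1) (x : ℂ) :
    qInf q x = (1 - x) * qInf q (x * q) := by
  have hm : ∀ y : ℂ, Multipliable fun n : ℕ => (1 - y * q ^ n) := by
    intro y
    have h : Summable fun n : ℕ => ‖-(y * q ^ n)‖ := by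
      simp only [norm_neg, norm_mul, norm_pow]
      exact (summable_geometric_of_lt_one (norm_nonneg q) hq).mul_left _
    simpa [sub_eq_add_neg] using multipliable_one_add_of_summable h
  have hs : (fun n : ℕ => 1 - x * q ^ (n + 1)) = fun n : ℕ => 1 - x * q * q ^ n := by
    funext n; ring
  unfold qInf
  rw [tprod_eq_zero_mul' (f := fun n : ℕ => 1 - x * q ^ n) (by rw [hs]; exact hm (x * q)), hs]
  simp

theorem qPoch_eq_div {q : ℂ} (hq0 : q ≠ 0) (hq : ‖q‖ < 1) (x : ℂ) (n : ℤ)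
    (h : qInf q (q ^ n * x) ≠ 0) : qPoch q x n = qInf q x / qInf q (q ^ n * x) := by
  have hnat : ∀ (n : ℕ) (y : ℂ),
      qInf q y = (∏ k ∈ Finset.range n, (1 - y * q ^ k)) * qInf q (y * q ^ n) := by
    intro n y
    induction n with
    | zero => simp
    | succ n ih =>
      rw [ih, Finset.prod_range_succ, qInf_eq_mul hq (y * q ^ n), pow_succ]
      ring_nf
  cases n with
  | ofNat n =>
    rw [eq_div_iff h, hnat n x]
    simp [qPoch, mul_comm]
  | negSucc n =>
    have e : q ^ (Int.negSucc n) * x * q ^ (n + 1) = x := by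
      rw [zpow_negSucc]; field_simp
    have h2 := hnat (n + 1) (q ^ (Int.negSucc n) * x)
    rw [e] at h2
    have e2 : (∏ k ∈ Finset.range (n + 1), (1 - q ^ (Int.negSucc n) * x * q ^ k))
        = ∏ k ∈ Finset.range (n + 1), (1 - x / q ^ (k + 1)) := by
      rw [← Finset.prod_range_reflect]
      refine Finset.prod_congr rfl fun k hk => ?_
      have hk' : k ≤ n := Nat.lt_succ_iff.mp (Finset.mem_range.mp hk)
      have e3 : q ^ (n + 1) = q ^ (n - k) * q ^ (k + 1) := by
        rw [← pow_add]; congr 1; omega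
      rw [zpow_negSucc, e3, show n + 1 - 1 - k = n - k by omega]
      field_simp
    rw [e2] at h2
    simp only [qPoch]
    rw [h2]
    have h3 : qInf q x ≠ 0 := fun h0 => h (by rw [h2, h0, mul_zero])
    rw [inv_eq_one_div, ← div_div, eq_comm, div_right_comm, div_self h3]

end QSeries

end

/-!
With `B = 1 / b`, the quotient `(b; q)_n / (a q / b; q)_n` is, up to `b ^ n` and a factor
independent of `n`, entire in `B`. In these normalised terms the very-well-poised `₆ψ₆` series
satisfies a contiguous relation between `B` and `B q`, since the difference of the two sides
telescopes. Iterating sends `B` to `0`, and doing this for all four parameters determines the sum up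
to a factor depending only on `a` and `q`, which is read off at `B = 1`, `C = 1 / a`, where a single
term survives. This is Bailey's sum; with all four parameters equal to `0` it is the Jacobi triple
product, its two halves being the even and odd parts of the theta series.

For the `₈ψ₈` series put `y = a / z`. Since `d e = y z = a`, the normalised factors of the pair
`d, e` multiply to `θ(d) θ(e) / ((1 - d q ^ n) (1 - e q ^ n))` up to a power of `a`, and likewise
for `y, z`. As a function of `q ^ n`, the remaining polynomial factor is a combination of
`(1 - d q ^ n) (1 - e q ^ n)` and `(1 - y q ^ n) (1 - z q ^ n)`, so `y + z - d - e` times the `₈ψ₈`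
term is a combination of two `₆ψ₆` terms, both of which Bailey's formula sums.
-/

noncomputable section

namespace QSeries

open Filter Topology Finset

variable {q : ℂ}

/-! ### Infinite shifted factorials -/

theorem summable_norm_mul_pow (hq : ‖q‖ < 1) (x : ℂ) : Summable fun n : ℕ => ‖-(x * q ^ n)‖ := by
  simp only [norm_neg, norm_mul, norm_pow]
  exact (summable_geometric_of_lt_one (norm_nonneg q) hq).mul_left _

theorem tendsto_prod_qInf (hq : ‖q‖ < 1) (x : ℂ) :
    Tendsto (fun N : ℕ => ∏ k ∈ range N, (1 - x * q ^ k)) atTop (𝓝 (qInf q x)) := by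
  have h : Multipliable fun n : ℕ => 1 - x * q ^ n := by
    simpa [sub_eq_add_neg] using multipliable_one_add_of_summable (summable_norm_mul_pow hq x)
  exact h.hasProd.tendsto_prod_nat

theorem qInf_ne_zero (hq : ‖q‖ < 1) {x : ℂ} (hx : ∀ k : ℕ, x * q ^ k ≠ 1) : qInf q x ≠ 0 := by
  have h := tprod_one_add_ne_zero_of_summable (f := fun n : ℕ => -(x * q ^ n))
    (fun i => by
      rw [← sub_eq_add_neg]
      exact sub_ne_zero.2 (hx i).symm) (summable_norm_mul_pow hq x)
  simpa [qInf, sub_eq_add_neg] using h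

theorem qInf_ne_zero_of_norm_lt_one (hq : ‖q‖ < 1) {x : ℂ} (hx : ‖x‖ < 1) : qInf q x ≠ 0 :=
  qInf_ne_zero hq fun k h => by
    have hk : ‖x * q ^ k‖ < 1 := by
      rw [norm_mul, norm_pow]
      exact mul_lt_one_of_nonneg_of_lt_one_left (norm_nonneg x) hx
        (pow_le_one₀ (norm_nonneg q) hq.le)
    rw [h, norm_one] at hk
    exact hk.false

@[simp]
theorem qInf_zero (q : ℂ) : qInf q 0 = 1 := by
  simp [qInf]

theorem qInf_inv_pow (hq0 : q ≠ 0) (hq : ‖q‖ < 1) (k : ℕ) : qInf q (q ^ k)⁻¹ = 0 := by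
  refine tendsto_nhds_unique (tendsto_prod_qInf hq _) (tendsto_const_nhds.congr' ?_)
  filter_upwards [eventually_gt_atTop k] with N hN
  refine (prod_eq_zero (mem_range.2 hN) ?_).symm
  rw [inv_mul_cancel₀ (pow_ne_zero k hq0), sub_self]

theorem qInf_mul_zpow (hq0 : q ≠ 0) (hq : ‖q‖ < 1) (x : ℂ) (m : ℤ) :
    qInf q (x * q ^ m) = (1 - x * q ^ m) * qInf q (x * q ^ (m + 1)) := by
  rw [qInf_eq_mul hq, mul_assoc x, ← zpow_add_one₀ hq0]

theorem norm_qInf_le (hq : ‖q‖ < 1) {x y : ℂ} (h : ‖x‖ ≤ ‖y‖) :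
    ‖qInf q x‖ ≤ ‖qInf (‖q‖ : ℂ) (-‖y‖ : ℂ)‖ := by
  have hq' : ‖(‖q‖ : ℂ)‖ < 1 := by simpa using hq
  refine le_of_tendsto_of_tendsto' (tendsto_prod_qInf hq x).norm
    (tendsto_prod_qInf hq' (-‖y‖)).norm fun N => ?_
  rw [norm_prod, norm_prod]
  refine prod_le_prod (fun _ _ => norm_nonneg _) fun k _ => ?_
  have hk : ‖(1 - -‖y‖ * ‖q‖ ^ k : ℂ)‖ = 1 + ‖y‖ * ‖q‖ ^ k := by
    rw [neg_mul, sub_neg_eq_add]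
    exact_mod_cast Real.norm_of_nonneg (by positivity)
  calc ‖1 - x * q ^ k‖ ≤ ‖(1 : ℂ)‖ + ‖x * q ^ k‖ := norm_sub_le _ _
    _ = 1 + ‖x‖ * ‖q‖ ^ k := by rw [norm_one, norm_mul, norm_pow]
    _ ≤ 1 + ‖y‖ * ‖q‖ ^ k := by gcongr
    _ = ‖(1 - -‖y‖ * ‖q‖ ^ k : ℂ)‖ := hk.symm

theorem norm_qInf_sub_one_le (hq : ‖q‖ < 1) (x : ℂ) :
    ‖qInf q x - 1‖ ≤ Real.exp (‖x‖ * (1 - ‖q‖)⁻¹) - 1 := by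
  refine le_of_tendsto' ((tendsto_prod_qInf hq x).sub_const 1).norm fun N => ?_
  have hsum : ∑ k ∈ range N, ‖-(x * q ^ k)‖ ≤ ‖x‖ * (1 - ‖q‖)⁻¹ := by
    simp only [norm_neg, norm_mul, norm_pow, ← mul_sum,
      ← tsum_geometric_of_lt_one (norm_nonneg q) hq]
    gcongr
    exact (summable_geometric_of_lt_one (norm_nonneg q) hq).sum_le_tsum _ fun _ _ => by positivity
  calc ‖∏ k ∈ range N, (1 - x * q ^ k) - 1‖
      ≤ Real.exp (∑ k ∈ range N, ‖-(x * q ^ k)‖) - 1 := by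
        simpa only [sub_eq_add_neg] using
          norm_prod_one_add_sub_one_le (range N) fun k => -(x * q ^ k)
    _ ≤ _ := by gcongr

theorem tendsto_qInf_nhds_zero (hq : ‖q‖ < 1) : Tendsto (qInf q) (𝓝 0) (𝓝 1) := by
  have h : Continuous fun x : ℂ => Real.exp (‖x‖ * (1 - ‖q‖)⁻¹) - 1 := by fun_prop
  exact tendsto_iff_norm_sub_tendsto_zero.2 <| squeeze_zero (fun _ => norm_nonneg _)
    (norm_qInf_sub_one_le hq) (by simpa using h.tendsto 0)

/-! ### Theta functions -/

/-- The coefficient of `x ^ n` in the series `(q; q)_∞ θ(x)`. -/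
def thetaCoeff (q : ℂ) (n : ℤ) : ℂ := (-1) ^ n * q ^ (n * (n - 1) / 2)

@[simp]
theorem thetaCoeff_zero (q : ℂ) : thetaCoeff q 0 = 1 := by
  simp [thetaCoeff]

@[simp]
theorem thetaCoeff_one (q : ℂ) : thetaCoeff q 1 = -1 := by
  simp [thetaCoeff]

theorem norm_thetaCoeff (q : ℂ) (n : ℤ) : ‖thetaCoeff q n‖ = ‖thetaCoeff (‖q‖ : ℂ) n‖ := by
  simp [thetaCoeff]

theorem thetaCoeff_add (hq0 : q ≠ 0) (m n : ℤ) :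
    thetaCoeff q (m + n) = thetaCoeff q m * thetaCoeff q n * q ^ (m * n) := by
  have h : (m + n) * (m + n - 1) / 2 = m * (m - 1) / 2 + n * (n - 1) / 2 + m * n := by
    have := Int.even_mul_pred_self m
    have := Int.even_mul_pred_self n
    rw [show (m + n) * (m + n - 1) = m * (m - 1) + n * (n - 1) + 2 * (m * n) by ring]
    grind
  rw [thetaCoeff, h, zpow_add₀ hq0, zpow_add₀ hq0, zpow_add₀ (by norm_num), thetaCoeff, thetaCoeff]
  ring

theorem thetaCoeff_add_one (hq0 : q ≠ 0) (n : ℤ) :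
    thetaCoeff q (n + 1) = -(q ^ n * thetaCoeff q n) := by
  rw [thetaCoeff_add hq0, thetaCoeff_one, mul_one]
  ring

theorem thetaCoeff_mul_self (hq0 : q ≠ 0) (n : ℤ) :
    thetaCoeff q n * thetaCoeff q n = q ^ (n * (n - 1)) := by
  have h : n * (n - 1) / 2 + n * (n - 1) / 2 = n * (n - 1) := by
    have := Int.even_mul_pred_self n
    grind
  rw [← h, zpow_add₀ hq0, thetaCoeff, mul_mul_mul_comm, ← mul_zpow]
  simp

theorem thetaCoeff_neg (hq0 : q ≠ 0) (n : ℤ) : thetaCoeff q (-n) = q ^ n * thetaCoeff q n := by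
  rw [thetaCoeff, thetaCoeff, mul_left_comm, ← zpow_add₀ hq0, zpow_neg, ← inv_zpow]
  have h : -n * (-n - 1) / 2 = n + n * (n - 1) / 2 := by
    have := Int.even_mul_pred_self n
    rw [show -n * (-n - 1) = n * (n - 1) + 2 * n by ring]
    grind
  rw [h]
  norm_num

theorem theta_eq_tsum (q x : ℂ) : theta q x = (∑' n : ℤ, thetaCoeff q n * x ^ n) / qInf q q :=
  rfl

theorem thetaCoeff_mul_theta_mul_zpow (hq0 : q ≠ 0) {x : ℂ} (hx : x ≠ 0) (n : ℤ) :
    thetaCoeff q n * x ^ n * theta q (x * q ^ n) = theta q x := by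
  rw [theta_eq_tsum, theta_eq_tsum, mul_div_assoc', ← tsum_mul_left,
    ← (Equiv.addRight n).tsum_eq fun m => thetaCoeff q m * x ^ m]
  congr 2 with m
  rw [Equiv.coe_addRight, thetaCoeff_add hq0, zpow_add₀ hx, mul_zpow, ← zpow_mul, mul_comm n m]
  ring

/-! ### Well-poised factors -/

/-- The well-poised factor with upper parameter `b = B⁻¹`, normalised so as to be entire in `B`:
it is `b ^ (-n) (b; q)_n / (a q / b; q)_n` times `(q / b, a q / b; q)_∞`, see
`qPoch_div_qPoch_eq_wpFactor`. -/
def wpFactor (q a B : ℂ) (n : ℤ) : ℂ :=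
  thetaCoeff q n * (qInf q (B * q ^ (1 - n)) * qInf q (a * B * q ^ (n + 1)))

@[simp]
theorem wpFactor_zero_left (q a : ℂ) (n : ℤ) : wpFactor q a 0 n = thetaCoeff q n := by
  simp [wpFactor]

theorem wpFactor_mul_one_sub (hq0 : q ≠ 0) (hq : ‖q‖ < 1) (a B : ℂ) (n : ℤ) :
    wpFactor q a B n * (1 - a * B * q ^ n) = wpFactor q (a / q) B n := by
  have h : a / q * B * q ^ (n + 1) = a * B * q ^ n := by
    rw [zpow_add_one₀ hq0]
    field_simp
  rw [wpFactor, wpFactor, h, qInf_mul_zpow hq0 hq (a * B) n]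
  ring

theorem wpFactor_mul_sub (hq0 : q ≠ 0) (hq : ‖q‖ < 1) (a B : ℂ) (n : ℤ) :
    wpFactor q a B n * (B - q ^ n) = wpFactor q (a / q) B (n + 1) := by
  have h₁ : a / q * B * q ^ (n + 1 + 1) = a * B * q ^ (n + 1) := by
    rw [zpow_add_one₀ hq0 (n + 1)]
    field_simp
  have h₂ : q ^ n * q ^ (-n) = 1 := by rw [← zpow_add₀ hq0, add_neg_cancel, zpow_zero]
  rw [wpFactor, wpFactor, h₁, show 1 - (n + 1) = -n by ring, qInf_mul_zpow hq0 hq B (-n),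
    thetaCoeff_add_one hq0, neg_add_eq_sub]
  linear_combination -thetaCoeff q n * B * qInf q (B * q ^ (1 - n)) *
    qInf q (a * B * q ^ (n + 1)) * h₂

theorem wpFactor_add_one (hq0 : q ≠ 0) (hq : ‖q‖ < 1) (a B : ℂ) (n : ℤ) :
    wpFactor q a B (n + 1) * (1 - a * q * B * q ^ n) = wpFactor q a B n * (B - q ^ n) := by
  rw [wpFactor_mul_sub hq0 hq, ← wpFactor_mul_one_sub hq0 hq, zpow_add_one₀ hq0]
  ring

theorem zpow_mul_wpFactor (hq0 : q ≠ 0) (hq : ‖q‖ < 1) (a B : ℂ) (n : ℤ) :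
    q ^ n * wpFactor q a B n =
      (q ^ n - B * q) * (1 - a * (B * q) * q ^ n) * wpFactor q a (B * q) n := by
  have h₁ : qInf q (B * q ^ (1 - n)) =
      (1 - B * q ^ (1 - n)) * qInf q (B * q * q ^ (1 - n)) := by
    rw [qInf_eq_mul hq, mul_right_comm]
  have h₂ : qInf q (a * B * q ^ (n + 1)) =
      (1 - a * (B * q) * q ^ n) * qInf q (a * (B * q) * q ^ (n + 1)) := by
    rw [qInf_eq_mul hq, zpow_add_one₀ hq0]
    ring_nf
  have h₃ : q ^ n * q ^ (1 - n) = q := by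
    rw [← zpow_add₀ hq0, add_sub_cancel, zpow_one]
  rw [wpFactor, wpFactor, h₁, h₂]
  linear_combination -thetaCoeff q n * B * qInf q (B * q * q ^ (1 - n)) *
    (1 - a * (B * q) * q ^ n) * qInf q (a * (B * q) * q ^ (n + 1)) * h₃

theorem wpFactor_neg (hq0 : q ≠ 0) {a : ℂ} (ha : a ≠ 0) (B : ℂ) (n : ℤ) :
    wpFactor q a B (-n) = q ^ n * wpFactor q a⁻¹ (a * B) n := by
  rw [wpFactor, wpFactor, thetaCoeff_neg hq0, inv_mul_cancel_left₀ ha, sub_neg_eq_add,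
    neg_add_eq_sub, add_comm 1 n]
  ring

theorem wpFactor_one_of_pos (hq0 : q ≠ 0) (hq : ‖q‖ < 1) (a : ℂ) {n : ℤ} (hn : 0 < n) :
    wpFactor q a 1 n = 0 := by
  obtain ⟨k, rfl⟩ : ∃ k : ℕ, n = k + 1 := ⟨(n - 1).toNat, by omega⟩
  rw [wpFactor, sub_add_cancel_right, zpow_neg, zpow_natCast, one_mul, qInf_inv_pow hq0 hq,
    zero_mul, mul_zero]

theorem wpFactor_inv_of_neg (hq0 : q ≠ 0) (hq : ‖q‖ < 1) {a : ℂ} (ha : a ≠ 0) {n : ℤ}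
    (hn : n < 0) : wpFactor q a a⁻¹ n = 0 := by
  have h := wpFactor_neg hq0 ha a⁻¹ (-n)
  rwa [neg_neg, mul_inv_cancel₀ ha, wpFactor_one_of_pos hq0 hq _ (neg_pos.2 hn), mul_zero] at h

theorem norm_wpFactor_le (hq : ‖q‖ < 1) {a B B' : ℂ} (h : ‖B‖ ≤ ‖B'‖) (n : ℤ) :
    ‖wpFactor q a B n‖ ≤ ‖wpFactor (‖q‖ : ℂ) (‖a‖ : ℂ) (-‖B'‖ : ℂ) n‖ := by
  have h₁ : ‖qInf q (B * q ^ (1 - n))‖ ≤ ‖qInf (‖q‖ : ℂ) (-‖B'‖ * (‖q‖ : ℂ) ^ (1 - n))‖ := by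
    have := norm_qInf_le hq (x := B * q ^ (1 - n)) (y := B' * q ^ (1 - n))
      (by rw [norm_mul, norm_mul]; gcongr)
    simpa using this
  have h₂ : ‖qInf q (a * B * q ^ (n + 1))‖ ≤
      ‖qInf (‖q‖ : ℂ) (‖a‖ * -‖B'‖ * (‖q‖ : ℂ) ^ (n + 1))‖ := by
    have := norm_qInf_le hq (x := a * B * q ^ (n + 1)) (y := a * B' * q ^ (n + 1))
      (by simp only [norm_mul]; gcongr)
    simpa using this
  rw [wpFactor, wpFactor, norm_mul, norm_mul, norm_mul, norm_mul, norm_thetaCoeff]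
  gcongr

theorem tendsto_wpFactor_mul_pow (hq : ‖q‖ < 1) (a B : ℂ) (n : ℤ) :
    Tendsto (fun N : ℕ => wpFactor q a (B * q ^ N) n) atTop (𝓝 (wpFactor q a 0 n)) := by
  have hpow : Tendsto (fun N : ℕ => B * q ^ N) atTop (𝓝 0) := by
    simpa using (tendsto_pow_atTop_nhds_zero_of_norm_lt_one hq).const_mul B
  have h₁ := (tendsto_qInf_nhds_zero hq).comp (by simpa using hpow.mul_const (q ^ (1 - n)))
  have h₂ := (tendsto_qInf_nhds_zero hq).comp
    (by simpa using (hpow.const_mul a).mul_const (q ^ (n + 1)))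
  simpa [wpFactor] using (h₁.mul h₂).const_mul (thetaCoeff q n)

/-- The product of the well-poised factors with upper parameters `B⁻¹` for `B` in the list `Bs`. -/
def wpFactors (q a : ℂ) (Bs : List ℂ) (n : ℤ) : ℂ := (Bs.map fun B => wpFactor q a B n).prod

theorem wpFactors_cons (q a B : ℂ) (Bs : List ℂ) (n : ℤ) :
    wpFactors q a (B :: Bs) n = wpFactor q a B n * wpFactors q a Bs n := by
  simp [wpFactors]

theorem wpFactors_add_one (hq0 : q ≠ 0) (hq : ‖q‖ < 1) (a : ℂ) (Bs : List ℂ) (n : ℤ) :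
    wpFactors q a Bs (n + 1) * (Bs.map fun B => 1 - a * q * B * q ^ n).prod =
      wpFactors q a Bs n * (Bs.map fun B => B - q ^ n).prod := by
  simp only [wpFactors, ← List.prod_map_mul, wpFactor_add_one hq0 hq]

theorem wpFactors_neg (hq0 : q ≠ 0) {a : ℂ} (ha : a ≠ 0) (Bs : List ℂ) (n : ℤ) :
    wpFactors q a Bs (-n) = (q ^ Bs.length) ^ n * wpFactors q a⁻¹ (Bs.map (a * ·)) n := by
  have h : (q ^ Bs.length) ^ n = (q ^ n) ^ Bs.length := by
    rw [← zpow_natCast, ← zpow_natCast, zpow_comm]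
  simp [wpFactors, wpFactor_neg hq0 ha, List.prod_map_mul, Function.comp_def, h]

theorem norm_wpFactors_le (hq : ‖q‖ < 1) {a : ℂ} {Bs Bs' : List ℂ}
    (h : List.Forall₂ (fun B B' => ‖B‖ ≤ ‖B'‖) Bs Bs') (n : ℤ) :
    ‖wpFactors q a Bs n‖ ≤
      ‖wpFactors (‖q‖ : ℂ) (‖a‖ : ℂ) (Bs'.map fun B' => (-‖B'‖ : ℂ)) n‖ := by
  induction h with
  | nil => simp [wpFactors]
  | cons hB _ ih =>
    rw [List.map_cons, wpFactors_cons, wpFactors_cons, norm_mul, norm_mul]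
    gcongr
    exact norm_wpFactor_le hq hB n

/-! ### Bailey's bilateral `₆ψ₆` sum -/

theorem summable_norm_of_mul_eq_mul {𝕜 : Type*} [NormedField 𝕜] {u v w : ℕ → 𝕜} {ρ : 𝕜}
    (h : ∀ n, u (n + 1) * v n = u n * w n) (hv : Tendsto v atTop (𝓝 1))
    (hw : Tendsto w atTop (𝓝 ρ)) (hρ : ‖ρ‖ < 1) :
    Summable fun n => ‖u n‖ := by
  have hlim : Tendsto (fun n => ‖w n / v n‖) atTop (𝓝 ‖ρ‖) := by
    simpa using (hw.div hv one_ne_zero).norm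
  obtain ⟨s, hρs, hs⟩ := exists_between hρ
  refine summable_of_ratio_norm_eventually_le hs ?_
  filter_upwards [hlim.eventually_lt_const hρs, hv.eventually_ne one_ne_zero] with n hn hvn
  rw [norm_norm, norm_norm, eq_div_of_mul_eq hvn (h n), mul_div_assoc, norm_mul, mul_comm]
  gcongr

theorem summable_norm_natCast_zpow_mul_wpFactors (hq0 : q ≠ 0) (hq : ‖q‖ < 1) (a : ℂ) {y : ℂ}
    {Bs : List ℂ} (h : ‖y * Bs.prod‖ < 1) :
    Summable fun n : ℕ => ‖y ^ (n : ℤ) * wpFactors q a Bs n‖ := by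
  have hpow := tendsto_pow_atTop_nhds_zero_of_norm_lt_one hq
  have hv : Tendsto (fun n : ℕ => (Bs.map fun B => 1 - a * q * B * q ^ n).prod) atTop (𝓝 1) := by
    simpa using tendsto_list_prod Bs fun B _ => (hpow.const_mul (a * q * B)).const_sub 1
  have hw : Tendsto (fun n : ℕ => (Bs.map fun B => B - q ^ n).prod) atTop (𝓝 Bs.prod) := by
    have h := tendsto_list_prod Bs fun B _ => hpow.const_sub B
    simpa only [sub_zero, List.map_id'] using h
  refine summable_norm_of_mul_eq_mul (fun n => ?_) hv (hw.const_mul y) h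
  have hrec := wpFactors_add_one hq0 hq a Bs n
  simp only [zpow_natCast] at hrec ⊢
  rw [pow_succ, Nat.cast_succ]
  linear_combination (y ^ n * y) * hrec

theorem summable_norm_zpow_mul_wpFactors (hq0 : q ≠ 0) (hq : ‖q‖ < 1) {a y : ℂ} (ha : a ≠ 0)
    {Bs : List ℂ} (hpos : ‖y * Bs.prod‖ < 1)
    (hneg : ‖(a * q) ^ Bs.length / y * Bs.prod‖ < 1) :
    Summable fun n : ℤ => ‖y ^ n * wpFactors q a Bs n‖ := by
  refine Summable.of_nat_of_neg (summable_norm_natCast_zpow_mul_wpFactors hq0 hq a hpos) ?_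
  have h : ‖q ^ Bs.length / y * (Bs.map (a * ·)).prod‖ < 1 := by
    rw [List.prod_map_mul, List.map_const', List.prod_replicate, List.map_id']
    convert hneg using 2
    ring
  refine (summable_norm_natCast_zpow_mul_wpFactors hq0 hq a⁻¹ h).congr fun n => ?_
  rw [wpFactors_neg hq0 ha, ← mul_assoc, zpow_neg, ← inv_zpow, ← mul_zpow, div_eq_inv_mul]

/-- The general term of the very-well-poised `₆ψ₆` series with upper parameters
`B⁻¹, C⁻¹, D⁻¹, E⁻¹`, normalised as in `wpFactor` so as to be entire in `B, C, D, E`. -/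
def sixPsiTerm (q a B C D E : ℂ) (n : ℤ) : ℂ :=
  (a ^ 2 * q) ^ n * (1 - a * (q ^ n) ^ 2) * wpFactors q a [B, C, D, E] n

theorem sixPsiTerm_eq_sub (q a B C D E : ℂ) (n : ℤ) :
    sixPsiTerm q a B C D E n = (a ^ 2 * q) ^ n * wpFactors q a [B, C, D, E] n -
      a * ((a ^ 2 * q ^ 3) ^ n * wpFactors q a [B, C, D, E] n) := by
  have h : (a ^ 2 * q ^ 3) ^ n = (a ^ 2 * q) ^ n * (q ^ n) ^ 2 := by
    rw [← zpow_natCast (q ^ n), ← zpow_mul, mul_comm n, zpow_mul, ← mul_zpow]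
    norm_cast
    ring_nf
  rw [sixPsiTerm, h]
  ring

theorem summable_norm_sixPsiTerm_parts (hq0 : q ≠ 0) (hq : ‖q‖ < 1) {a B C D E : ℂ} (ha : a ≠ 0)
    (h : ‖a ^ 2 * q * [B, C, D, E].prod‖ < 1) :
    Summable (fun n : ℤ => ‖(a ^ 2 * q) ^ n * wpFactors q a [B, C, D, E] n‖) ∧
    Summable (fun n : ℤ => ‖(a ^ 2 * q ^ 3) ^ n * wpFactors q a [B, C, D, E] n‖) := by
  have h' : ‖a ^ 2 * q ^ 3 * [B, C, D, E].prod‖ < 1 := by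
    rw [show a ^ 2 * q ^ 3 * [B, C, D, E].prod = q ^ 2 * (a ^ 2 * q * [B, C, D, E].prod) by ring,
      norm_mul, norm_pow]
    exact mul_lt_one_of_nonneg_of_lt_one_right (pow_le_one₀ (norm_nonneg q) hq.le)
      (norm_nonneg _) h
  have e₁ : (a * q) ^ 4 / (a ^ 2 * q) = a ^ 2 * q ^ 3 := by field_simp
  have e₂ : (a * q) ^ 4 / (a ^ 2 * q ^ 3) = a ^ 2 * q := by field_simp
  exact ⟨summable_norm_zpow_mul_wpFactors hq0 hq ha h (e₁ ▸ h'),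
    summable_norm_zpow_mul_wpFactors hq0 hq ha h' (e₂ ▸ h)⟩

theorem summable_sixPsiTerm (hq0 : q ≠ 0) (hq : ‖q‖ < 1) {a B C D E : ℂ} (ha : a ≠ 0)
    (h : ‖a ^ 2 * q * [B, C, D, E].prod‖ < 1) : Summable (sixPsiTerm q a B C D E) := by
  obtain ⟨h₁, h₂⟩ := summable_norm_sixPsiTerm_parts hq0 hq ha h
  exact (h₁.of_norm.sub (h₂.of_norm.mul_left a)).congr fun n => (sixPsiTerm_eq_sub ..).symm

theorem one_sub_mul_sixPsiTerm (hq0 : q ≠ 0) (hq : ‖q‖ < 1) {a : ℂ} (ha : a ≠ 0) (B C D E : ℂ)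
    (n : ℤ) {H : ℤ → ℂ}
    (hH : H = fun n => (a ^ 2) ^ n * wpFactors q (a / q) [B * q, C, D, E] n) :
    (1 - a ^ 2 * q * (B * C * D * E)) * sixPsiTerm q a B C D E n =
      (1 - a * q * (B * C)) * (1 - a * q * (B * D)) * (1 - a * q * (B * E)) *
        sixPsiTerm q a (B * q) C D E n + B * q * (H (n + 1) - H n) := by
  simp only [hH, sixPsiTerm, wpFactors, List.map_cons, List.map_nil, List.prod_cons, List.prod_nil,
    ← wpFactor_mul_sub hq0 hq]
  simp only [← wpFactor_mul_one_sub hq0 hq]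
  rw [mul_zpow, zpow_add_one₀ (pow_ne_zero 2 ha)]
  linear_combination (a ^ 2) ^ n * (1 - a ^ 2 * q * (B * C * D * E)) * (1 - a * (q ^ n) ^ 2) *
    wpFactor q a C n * wpFactor q a D n * wpFactor q a E n * zpow_mul_wpFactor hq0 hq a B n

theorem norm_mul_prod_mul_lt_one {𝕜 : Type*} [NormedField 𝕜] {r y B : 𝕜} {Bs : List 𝕜}
    (hr : ‖r‖ ≤ 1) (h : ‖y * (B :: Bs).prod‖ < 1) : ‖y * (B * r :: Bs).prod‖ < 1 := by
  rw [List.prod_cons] at h ⊢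
  rw [show y * (B * r * Bs.prod) = r * (y * (B * Bs.prod)) by ring, norm_mul]
  exact mul_lt_one_of_nonneg_of_lt_one_right hr (norm_nonneg _) h

theorem tsum_sixPsiTerm_contiguous (hq0 : q ≠ 0) (hq : ‖q‖ < 1) {a B C D E : ℂ} (ha : a ≠ 0)
    (h : ‖a ^ 2 * q * [B, C, D, E].prod‖ < 1) :
    (1 - a ^ 2 * q * (B * C * D * E)) * ∑' n, sixPsiTerm q a B C D E n =
      (1 - a * q * (B * C)) * (1 - a * q * (B * D)) * (1 - a * q * (B * E)) *
        ∑' n, sixPsiTerm q a (B * q) C D E n := by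
  obtain ⟨H, hH⟩ : ∃ H : ℤ → ℂ,
      H = fun n => (a ^ 2) ^ n * wpFactors q (a / q) [B * q, C, D, E] n := ⟨_, rfl⟩
  have hHsum : Summable H := by
    have hn : ‖a ^ 2 * [B * q, C, D, E].prod‖ < 1 := by
      convert h using 2
      simp only [List.prod_cons]
      ring
    rw [hH]
    refine (summable_norm_zpow_mul_wpFactors hq0 hq (div_ne_zero ha hq0) hn ?_).of_norm
    convert hn using 3
    simp only [List.length_cons, List.length_nil]
    field_simp
  have hshift : ∑' n, H (n + 1) = ∑' n, H n := (Equiv.addRight (1 : ℤ)).tsum_eq H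
  have hHsum' : Summable fun n => H (n + 1) := (Equiv.addRight (1 : ℤ)).summable_iff.2 hHsum
  have h' := norm_mul_prod_mul_lt_one hq.le h
  rw [← tsum_mul_left, tsum_congr fun n => one_sub_mul_sixPsiTerm hq0 hq ha B C D E n hH,
    ((summable_sixPsiTerm hq0 hq ha h').mul_left _).tsum_add ((hHsum'.sub hHsum).mul_left _),
    tsum_mul_left, tsum_mul_left, hHsum'.tsum_sub hHsum, hshift, sub_self, mul_zero, add_zero]

theorem norm_mul_pow_le (hq : ‖q‖ ≤ 1) (B : ℂ) (N : ℕ) : ‖B * q ^ N‖ ≤ ‖B‖ := by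
  rw [norm_mul, norm_pow]
  exact mul_le_of_le_one_right (norm_nonneg B) (pow_le_one₀ (norm_nonneg q) hq)

theorem tendsto_tsum_sixPsiTerm_mul_pow (hq0 : q ≠ 0) (hq : ‖q‖ < 1) {a B C D E : ℂ} (ha : a ≠ 0)
    (h : ‖a ^ 2 * q * [B, C, D, E].prod‖ < 1) :
    Tendsto (fun N : ℕ => ∑' n, sixPsiTerm q a (B * q ^ N) C D E n) atTop
      (𝓝 (∑' n, sixPsiTerm q a 0 C D E n)) := by
  obtain ⟨h₁, h₂⟩ := summable_norm_sixPsiTerm_parts (q := ‖q‖) (a := ‖a‖) (B := -‖B‖)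
    (C := -‖C‖) (D := -‖D‖) (E := -‖E‖) (by simpa using hq0) (by simpa using hq)
    (by simpa using ha) (by simpa using h)
  refine tendsto_tsum_of_dominated_convergence (h₁.add (h₂.mul_left ‖a‖)) (fun n => ?_)
    (.of_forall fun N n => ?_)
  · have hB := tendsto_wpFactor_mul_pow hq a B n
    simpa only [sixPsiTerm, wpFactors_cons] using (hB.mul_const _).const_mul _
  · have hle := norm_wpFactors_le hq (a := a) (Bs := [B * q ^ N, C, D, E]) (Bs' := [B, C, D, E])
      (.cons (norm_mul_pow_le hq.le B N) (List.forall₂_same.2 fun _ _ => le_rfl)) n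
    simp only [List.map_cons, List.map_nil] at hle
    rw [sixPsiTerm_eq_sub]
    refine (norm_sub_le _ _).trans ?_
    simp only [norm_mul, norm_zpow, norm_pow, Complex.norm_real, norm_norm] at hle ⊢
    gcongr

theorem qInf_mul_tsum_sixPsiTerm (hq0 : q ≠ 0) (hq : ‖q‖ < 1) {a B C D E : ℂ} (ha : a ≠ 0)
    (h : ‖a ^ 2 * q * [B, C, D, E].prod‖ < 1) :
    qInf q (a ^ 2 * q * (B * C * D * E)) * ∑' n, sixPsiTerm q a B C D E n =
      qInf q (a * q * (B * C)) * qInf q (a * q * (B * D)) * qInf q (a * q * (B * E)) *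
        ∑' n, sixPsiTerm q a 0 C D E n := by
  have hN (N : ℕ) : (∏ k ∈ range N, (1 - a ^ 2 * q * (B * C * D * E) * q ^ k)) *
        ∑' n, sixPsiTerm q a B C D E n =
      (∏ k ∈ range N, (1 - a * q * (B * C) * q ^ k)) *
        (∏ k ∈ range N, (1 - a * q * (B * D) * q ^ k)) *
        (∏ k ∈ range N, (1 - a * q * (B * E) * q ^ k)) *
        ∑' n, sixPsiTerm q a (B * q ^ N) C D E n := by
    induction N with
    | zero => simp
    | succ N ih =>
      have hpow : ‖q ^ N‖ ≤ 1 := by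
        rw [norm_pow]
        exact pow_le_one₀ (norm_nonneg q) hq.le
      have hstep := tsum_sixPsiTerm_contiguous hq0 hq ha (norm_mul_prod_mul_lt_one hpow h)
      rw [mul_assoc B _ q, ← pow_succ] at hstep
      simp only [prod_range_succ]
      linear_combination (1 - a ^ 2 * q * (B * C * D * E) * q ^ N) * ih +
        (∏ k ∈ range N, (1 - a * q * (B * C) * q ^ k)) *
        (∏ k ∈ range N, (1 - a * q * (B * D) * q ^ k)) *
        (∏ k ∈ range N, (1 - a * q * (B * E) * q ^ k)) * hstep
  have hlim (x : ℂ) := tendsto_prod_qInf hq x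
  refine tendsto_nhds_unique ((hlim _).mul_const _) ?_
  simp only [hN]
  exact (((hlim _).mul (hlim _)).mul (hlim _)).mul (tendsto_tsum_sixPsiTerm_mul_pow hq0 hq ha h)

theorem qInf_mul_tsum_sixPsiTerm_eq_zero_params (hq0 : q ≠ 0) (hq : ‖q‖ < 1) {a B C D E : ℂ}
    (ha : a ≠ 0) (h : ‖a ^ 2 * q * [B, C, D, E].prod‖ < 1) :
    qInf q (a ^ 2 * q * (B * C * D * E)) * ∑' n, sixPsiTerm q a B C D E n =
      qInfs q [a * q * (B * C), a * q * (B * D), a * q * (B * E), a * q * (C * D),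
        a * q * (C * E), a * q * (D * E)] * ∑' n, sixPsiTerm q a 0 0 0 0 n := by
  have hswap₂ (B C D E : ℂ) : sixPsiTerm q a B C D E = sixPsiTerm q a C B D E := by
    funext n
    simp only [sixPsiTerm, wpFactors_cons]
    ring
  have hswap₃ (B C D E : ℂ) : sixPsiTerm q a B C D E = sixPsiTerm q a D B C E := by
    funext n
    simp only [sixPsiTerm, wpFactors_cons]
    ring
  have hswap₄ (B C D E : ℂ) : sixPsiTerm q a B C D E = sixPsiTerm q a E B C D := by
    funext n
    simp only [sixPsiTerm, wpFactors_cons]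
    ring
  have hC := qInf_mul_tsum_sixPsiTerm hq0 hq ha (B := C) (C := 0) (D := D) (E := E) (by simp)
  have hD := qInf_mul_tsum_sixPsiTerm hq0 hq ha (B := D) (C := 0) (D := 0) (E := E) (by simp)
  have hE := qInf_mul_tsum_sixPsiTerm hq0 hq ha (B := E) (C := 0) (D := 0) (E := 0) (by simp)
  simp only [mul_zero, zero_mul, qInf_zero, one_mul] at hC hD hE
  rw [qInf_mul_tsum_sixPsiTerm hq0 hq ha h, hswap₂ 0, hC, hswap₃ 0, hD, hswap₄ 0, hE]
  simp only [qInfs, List.map_cons, List.map_nil, List.prod_cons, List.prod_nil]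
  ring

theorem tsum_sixPsiTerm_zero_params (hq0 : q ≠ 0) (hq : ‖q‖ < 1) {a : ℂ} (ha : a ≠ 0) :
    ∑' n, sixPsiTerm q a 0 0 0 0 n = qInfs q [q, a, q / a] := by
  have hsingle : ∑' n, sixPsiTerm q a 1 a⁻¹ 0 0 n = sixPsiTerm q a 1 a⁻¹ 0 0 0 := by
    refine tsum_eq_single 0 fun n hn => ?_
    rw [sixPsiTerm, wpFactors_cons, wpFactors_cons]
    rcases hn.lt_or_gt with hneg | hpos
    · rw [wpFactor_inv_of_neg hq0 hq ha hneg, zero_mul, mul_zero, mul_zero]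
    · rw [wpFactor_one_of_pos hq0 hq a hpos, zero_mul, mul_zero]
  have hred := qInf_mul_tsum_sixPsiTerm_eq_zero_params hq0 hq ha (B := 1) (C := a⁻¹) (D := 0)
    (E := 0) (by simp)
  rw [hsingle] at hred
  have hval : sixPsiTerm q a 1 a⁻¹ 0 0 0 = qInf q q * (qInf q q * qInf q a * qInf q (q / a)) := by
    simp only [sixPsiTerm, wpFactors, wpFactor, List.map_cons, List.map_nil, List.prod_cons,
      List.prod_nil, qInf_eq_mul hq a]
    simp [mul_inv_cancel₀ ha, div_eq_inv_mul]
    ring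
  have hq' : a * q * a⁻¹ = q := by field_simp
  simp only [hval, hq', qInfs, List.map_cons, List.map_nil, List.prod_cons, List.prod_nil, mul_zero,
    qInf_zero, mul_one, one_mul] at hred ⊢
  exact (mul_left_cancel₀ (qInf_ne_zero_of_norm_lt_one hq hq) hred).symm.trans (mul_assoc _ _ _)

theorem thetaCoeff_two_mul_mul_zpow (hq0 : q ≠ 0) (a : ℂ) (n : ℤ) :
    thetaCoeff q (2 * n) * a ^ (2 * n) = (a ^ 2 * q) ^ n * wpFactors q a [0, 0, 0, 0] n := by
  have hcoeff : thetaCoeff q (2 * n) = q ^ n * (q ^ (n * (n - 1))) ^ 2 := by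
    rw [two_mul, thetaCoeff_add hq0, thetaCoeff_mul_self hq0, ← zpow_natCast, ← zpow_mul,
      ← zpow_add₀ hq0, ← zpow_add₀ hq0]
    congr 1
    push_cast
    ring
  rw [hcoeff, ← thetaCoeff_mul_self hq0, zpow_mul, zpow_ofNat, mul_zpow]
  simp only [wpFactors, wpFactor_zero_left, List.map_cons, List.map_nil, List.prod_cons,
    List.prod_nil]
  ring

theorem thetaCoeff_two_mul_add_one_mul_zpow (hq0 : q ≠ 0) {a : ℂ} (ha : a ≠ 0) (n : ℤ) :
    thetaCoeff q (2 * n + 1) * a ^ (2 * n + 1) =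
      -(a * ((a ^ 2 * q ^ 3) ^ n * wpFactors q a [0, 0, 0, 0] n)) := by
  have h : (a ^ 2 * q ^ 3) ^ n = q ^ (2 * n) * (a ^ 2 * q) ^ n := by
    rw [zpow_mul, zpow_ofNat, ← mul_zpow]
    ring_nf
  rw [thetaCoeff_add_one hq0, zpow_add_one₀ ha, h]
  linear_combination -(a * q ^ (2 * n)) * thetaCoeff_two_mul_mul_zpow hq0 a n

theorem hasSum_of_even_of_odd {M : Type*} [AddCommMonoid M] [TopologicalSpace M] [ContinuousAdd M]
    {f : ℤ → M} {s t : M} (hs : HasSum (fun n => f (2 * n)) s)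
    (ht : HasSum (fun n => f (2 * n + 1)) t) : HasSum f (s + t) := by
  have hinj : Function.Injective fun n : ℤ => 2 * n := mul_right_injective₀ two_ne_zero
  replace ht := ((add_left_injective 1).comp hinj).hasSum_range_iff.2 ht
  refine (hinj.hasSum_range_iff.2 hs).add_isCompl ?_ ht
  simpa [Function.comp_def] using Int.isCompl_even_odd

theorem jacobi_triple_product (hq0 : q ≠ 0) (hq : ‖q‖ < 1) {a : ℂ} (ha : a ≠ 0) :
    theta q a = qInf q a * qInf q (q / a) := by
  obtain ⟨h₁, h₂⟩ := summable_norm_sixPsiTerm_parts hq0 hq ha (B := 0) (C := 0) (D := 0) (E := 0)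
    (by simp)
  obtain ⟨S, hS⟩ := h₁.of_norm
  obtain ⟨T, hT⟩ := h₂.of_norm
  have hsix : HasSum (sixPsiTerm q a 0 0 0 0) (S - a * T) :=
    (hS.sub (hT.mul_left a)).congr_fun fun n => sixPsiTerm_eq_sub ..
  have htheta : HasSum (fun n => thetaCoeff q n * a ^ n) (S + -(a * T)) := by
    refine hasSum_of_even_of_odd ?_ ?_
    · simpa only [thetaCoeff_two_mul_mul_zpow hq0] using hS
    · simpa only [thetaCoeff_two_mul_add_one_mul_zpow hq0 ha] using (hT.mul_left a).neg
  rw [theta_eq_tsum, htheta.tsum_eq, ← sub_eq_add_neg, ← hsix.tsum_eq,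
    tsum_sixPsiTerm_zero_params hq0 hq ha, div_eq_iff (qInf_ne_zero_of_norm_lt_one hq hq)]
  simp only [qInfs, List.map_cons, List.map_nil, List.prod_cons, List.prod_nil]
  ring

theorem bailey_six_psi_six (hq0 : q ≠ 0) (hq : ‖q‖ < 1) {a B C D E : ℂ} (ha : a ≠ 0)
    (h : ‖a ^ 2 * q * [B, C, D, E].prod‖ < 1) :
    qInf q (a ^ 2 * q * (B * C * D * E)) * ∑' n, sixPsiTerm q a B C D E n =
      qInfs q [q, a, q / a] * qInfs q [a * q * (B * C), a * q * (B * D), a * q * (B * E),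
        a * q * (C * D), a * q * (C * E), a * q * (D * E)] := by
  rw [qInf_mul_tsum_sixPsiTerm_eq_zero_params hq0 hq ha h, tsum_sixPsiTerm_zero_params hq0 hq ha,
    mul_comm]

/-! ### The balanced `₈ψ₈` series -/

theorem wpFactor_inv_mul_wpFactor_inv (hq0 : q ≠ 0) (hq : ‖q‖ < 1) {d e : ℂ} (hd : d ≠ 0)
    (he : e ≠ 0) (n : ℤ) :
    (d * e) ^ n * ((1 - d * q ^ n) * (1 - e * q ^ n)) *
      (wpFactor q (d * e) d⁻¹ n * wpFactor q (d * e) e⁻¹ n) = theta q d * theta q e := by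
  have htheta {x : ℂ} (hx : x ≠ 0) : thetaCoeff q n * x ^ n *
      ((1 - x * q ^ n) * qInf q (x * q ^ (n + 1)) * qInf q (x⁻¹ * q ^ (1 - n))) = theta q x := by
    have hqx : q / (x * q ^ n) = x⁻¹ * q ^ (1 - n) := by
      rw [zpow_sub₀ hq0, zpow_one]
      field_simp
    rw [← thetaCoeff_mul_theta_mul_zpow hq0 hx n,
      jacobi_triple_product hq0 hq (mul_ne_zero hx (zpow_ne_zero n hq0)),
      qInf_mul_zpow hq0 hq x n, hqx]
  rw [← htheta hd, ← htheta he, wpFactor, wpFactor, mul_inv_cancel_right₀ he,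
    mul_right_comm d e d⁻¹, mul_inv_cancel₀ hd, one_mul, mul_zpow]
  ring

theorem hasSum_sixPsiTerm_pair (hq0 : q ≠ 0) (hq : ‖q‖ < 1) {a d e B C : ℂ} (hd : d ≠ 0)
    (he : e ≠ 0) (hde : d * e = a) (h : ‖a * q * (B * C)‖ < 1) :
    HasSum (sixPsiTerm q a B C d⁻¹ e⁻¹) (qInfs q [q, q, a, q / a] *
      qInfs q [d * q * B, e * q * B, d * q * C, e * q * C]) := by
  subst hde
  have hprod : (d * e) ^ 2 * q * (B * C * d⁻¹ * e⁻¹) = d * e * q * (B * C) := by field_simp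
  have hd' (x : ℂ) : d * e * q * (x * d⁻¹) = e * q * x := by field_simp
  have he' (x : ℂ) : d * e * q * (x * e⁻¹) = d * q * x := by field_simp
  have hde : d * e * q * (d⁻¹ * e⁻¹) = q := by field_simp
  have hnorm : ‖(d * e) ^ 2 * q * [B, C, d⁻¹, e⁻¹].prod‖ < 1 := by
    rw [← hprod] at h
    simpa [mul_assoc] using h
  have hsum := bailey_six_psi_six hq0 hq (mul_ne_zero hd he) hnorm
  rw [hprod, hd', he', hd', he', hde] at hsum
  refine (summable_sixPsiTerm hq0 hq (mul_ne_zero hd he) hnorm).hasSum_iff.2 <|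
    mul_left_cancel₀ (qInf_ne_zero_of_norm_lt_one hq h) (hsum.trans ?_)
  simp only [qInfs, List.map_cons, List.map_nil, List.prod_cons, List.prod_nil]
  ring

/-- The general term of the very-well-poised `₈ψ₈` series with upper parameters `F⁻¹` for `F` in
the six-element list `Fs`, normalised as in `wpFactor` so as to be entire in these `F`. -/
def eightPsiTerm (q a : ℂ) (Fs : List ℂ) (n : ℤ) : ℂ :=
  (a ^ 3 * q ^ 2) ^ n * (1 - a * (q ^ n) ^ 2) * wpFactors q a Fs n

theorem mul_eightPsiTerm (hq0 : q ≠ 0) (hq : ‖q‖ < 1) {a d e y z : ℂ} (hd : d ≠ 0) (he : e ≠ 0)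
    (hy : y ≠ 0) (hz : z ≠ 0) (hde : d * e = a) (hyz : y * z = a) (B C : ℂ) (n : ℤ) :
    (y + z - d - e) * eightPsiTerm q a [B, C, d⁻¹, e⁻¹, y⁻¹, z⁻¹] n =
      (1 - y * (B * q)) * (1 - z * (B * q)) * (theta q d * theta q e) *
          sixPsiTerm q a (B * q) C y⁻¹ z⁻¹ n -
        (1 - d * (B * q)) * (1 - e * (B * q)) * (theta q y * theta q z) *
          sixPsiTerm q a (B * q) C d⁻¹ e⁻¹ n := by
  rw [← wpFactor_inv_mul_wpFactor_inv hq0 hq hd he n,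
    ← wpFactor_inv_mul_wpFactor_inv hq0 hq hy hz n, hde, hyz]
  have hX : (a ^ 3 * q ^ 2) ^ n = a ^ n * (a ^ 2 * q) ^ n * q ^ n := by
    rw [← mul_zpow, ← mul_zpow]
    ring_nf
  -- Both sides agree at `q ^ n = B * q`, and at `q ^ n = (a * B * q)⁻¹` because `d e = y z = a`.
  have hkey : (y + z - d - e) * ((q ^ n - B * q) * (1 - a * (B * q) * q ^ n)) =
      (1 - y * (B * q)) * (1 - z * (B * q)) * ((1 - d * q ^ n) * (1 - e * q ^ n)) -
        (1 - d * (B * q)) * (1 - e * (B * q)) * ((1 - y * q ^ n) * (1 - z * q ^ n)) := by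
    linear_combination
      ((B * q) ^ 2 * (1 - (y + z) * q ^ n) - (q ^ n) ^ 2 * (1 - (y + z) * (B * q))) * hde -
      ((B * q) ^ 2 * (1 - (d + e) * q ^ n) - (q ^ n) ^ 2 * (1 - (d + e) * (B * q))) * hyz
  simp only [eightPsiTerm, sixPsiTerm, wpFactors, List.map_cons, List.map_nil, List.prod_cons,
    List.prod_nil, hX]
  linear_combination a ^ n * (a ^ 2 * q) ^ n * (1 - a * (q ^ n) ^ 2) * (wpFactor q a C n *
    wpFactor q a d⁻¹ n * wpFactor q a e⁻¹ n * wpFactor q a y⁻¹ n * wpFactor q a z⁻¹ n) *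
    ((y + z - d - e) * zpow_mul_wpFactor hq0 hq a B n + wpFactor q a (B * q) n * hkey)

theorem hasSum_mul_eightPsiTerm (hq0 : q ≠ 0) (hq : ‖q‖ < 1) {a d e y z B C : ℂ} (hd : d ≠ 0)
    (he : e ≠ 0) (hy : y ≠ 0) (hz : z ≠ 0) (hde : d * e = a) (hyz : y * z = a)
    (h : ‖a * q ^ 2 * (B * C)‖ < 1) :
    HasSum (fun n => (y + z - d - e) * eightPsiTerm q a [B, C, d⁻¹, e⁻¹, y⁻¹, z⁻¹] n)
      (qInfs q [q, q, a, q / a] *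
        (thetas q [d, e] * qInfs q [y * q * B, z * q * B, y * q * C, z * q * C] -
          thetas q [y, z] * qInfs q [d * q * B, e * q * B, d * q * C, e * q * C])) := by
  have h' : ‖a * q * (B * q * C)‖ < 1 := by
    convert h using 2
    ring
  have hqInf (x : ℂ) : qInf q (x * q * B) = (1 - x * (B * q)) * qInf q (x * q * (B * q)) := by
    rw [qInf_eq_mul hq]
    ring_nf
  rw [funext (mul_eightPsiTerm hq0 hq hd he hy hz hde hyz B C)]
  have hsum := ((hasSum_sixPsiTerm_pair hq0 hq hy hz hyz h').mul_left
      ((1 - y * (B * q)) * (1 - z * (B * q)) * (theta q d * theta q e))).sub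
    ((hasSum_sixPsiTerm_pair hq0 hq hd he hde h').mul_left
      ((1 - d * (B * q)) * (1 - e * (B * q)) * (theta q y * theta q z)))
  refine (congrArg (HasSum _) ?_).mpr hsum
  simp only [qInfs, thetas, List.map_cons, List.map_nil, List.prod_cons, List.prod_nil, hqInf]
  ring

/-! ### Reduction to normalised terms -/

@[simp]
theorem qPoch_zero (q x : ℂ) : qPoch q x 0 = 1 :=
  prod_range_zero _

theorem qPoch_natCast_add_one (q x : ℂ) (n : ℕ) :
    qPoch q x (n + 1) = qPoch q x n * (1 - x * q ^ (n : ℤ)) :=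
  prod_range_succ _ n

theorem qPoch_neg_natCast_sub_one (q x : ℂ) (n : ℕ) :
    qPoch q x (-n - 1) = qPoch q x (-n) * (1 - x * q ^ (-n - 1 : ℤ))⁻¹ := by
  have h (m : ℕ) : qPoch q x (-m) = (∏ k ∈ range m, (1 - x / q ^ (k + 1)))⁻¹ := by
    cases m with
    | zero => simp
    | succ m => rfl
  have hn : (-n - 1 : ℤ) = -(n + 1 : ℕ) := by push_cast; ring
  rw [hn, h, h, prod_range_succ, mul_inv, zpow_neg, zpow_natCast, div_eq_mul_inv x (q ^ (n + 1))]

theorem qPoch_mul_div_qPoch (hq0 : q ≠ 0) {s : ℂ} (hs : ∀ n : ℤ, s * q ^ n ≠ 1) (n : ℤ) :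
    qPoch q (q * s) n / qPoch q s n = (1 - s * q ^ n) / (1 - s) := by
  have hs' (n : ℤ) : 1 - s * q ^ n ≠ 0 := sub_ne_zero.2 (hs n).symm
  have hqs (n : ℤ) : q * s * q ^ n = s * q ^ (n + 1) := by
    rw [zpow_add_one₀ hq0]
    ring
  have hs₁ : 1 - s ≠ 0 := by simpa using hs' 0
  induction n with
  | zero => simp [hs₁]
  | succ n ih =>
    rw [qPoch_natCast_add_one, qPoch_natCast_add_one, mul_div_mul_comm, ih, hqs,
      div_mul_div_comm, mul_comm (1 - s), mul_div_mul_left _ _ (hs' n)]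
  | pred n ih =>
    rw [qPoch_neg_natCast_sub_one, qPoch_neg_natCast_sub_one, mul_div_mul_comm, ih, hqs,
      sub_add_cancel]
    have := hs' (-n)
    field_simp

theorem qPoch_div_qPoch_eq_wpFactor (hq0 : q ≠ 0) (hq : ‖q‖ < 1) {a b : ℂ} (hb : b ≠ 0)
    (hU : ∀ k : ℕ, b ≠ q ^ (k + 1)) (hL : ∀ k : ℕ, a * q / b * q ^ k ≠ 1) (n : ℤ) :
    qPoch q b n / qPoch q (a * q / b) n * (qInf q (q / b) * qInf q (a * q / b)) =
      b ^ n * wpFactor q a b⁻¹ n := by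
  have hW (n : ℤ) : b ^ (n + 1) * wpFactor q a b⁻¹ (n + 1) * (1 - a * q / b * q ^ n) =
      b ^ n * wpFactor q a b⁻¹ n * (1 - b * q ^ n) := by
    have h := wpFactor_add_one hq0 hq a b⁻¹ n
    rw [← div_eq_mul_inv] at h
    rw [zpow_add_one₀ hb, mul_assoc, h]
    field_simp
  induction n with
  | zero =>
    simp only [qPoch_zero, wpFactor, thetaCoeff_zero, zpow_zero, sub_zero, zero_add, zpow_one]
    ring_nf
  | succ n ih =>
    have h : 1 - a * q / b * q ^ (n : ℤ) ≠ 0 := by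
      rw [zpow_natCast]
      exact sub_ne_zero.2 (hL n).symm
    rw [← mul_left_inj' h, hW, ← ih, qPoch_natCast_add_one, qPoch_natCast_add_one]
    generalize 1 - a * q / b * q ^ (n : ℤ) = u at h ⊢
    field_simp
  | pred n ih =>
    have h : 1 - b * q ^ (-n - 1 : ℤ) ≠ 0 := by
      intro h
      refine hU n ?_
      rw [← neg_add', zpow_neg, ← div_eq_mul_inv, sub_eq_zero,
        eq_div_iff (zpow_ne_zero _ hq0), one_mul] at h
      exact_mod_cast h.symm
    have hW' := hW (-n - 1)
    rw [sub_add_cancel, ← ih] at hW'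
    rw [← mul_left_inj' h, ← hW', qPoch_neg_natCast_sub_one, qPoch_neg_natCast_sub_one]
    generalize a * q / b = t
    field_simp

theorem qPochs_div_qPochs_eq_wpFactors (hq0 : q ≠ 0) (hq : ‖q‖ < 1) {a : ℂ} {as : List ℂ}
    (h0 : ∀ x ∈ as, x ≠ 0) (hU : ∀ x ∈ as, ∀ k : ℕ, x ≠ q ^ (k + 1))
    (hL : ∀ x ∈ as, ∀ k : ℕ, a * q / x * q ^ k ≠ 1) (n : ℤ) :
    qPochs q as n / qPochs q (as.map (a * q / ·)) n *
        (qInfs q (as.map (q / ·)) * qInfs q (as.map (a * q / ·))) =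
      as.prod ^ n * wpFactors q a (as.map (·⁻¹)) n := by
  induction as with
  | nil => simp [qPochs, qInfs, wpFactors]
  | cons b as ih =>
    simp only [List.forall_mem_cons] at h0 hU hL
    have hhead := qPoch_div_qPoch_eq_wpFactor hq0 hq h0.1 hU.1 hL.1 n
    have htail := ih h0.2 hU.2 hL.2
    simp only [qPochs, qInfs, List.map_cons, List.prod_cons, wpFactors_cons] at htail ⊢
    rw [mul_zpow, mul_mul_mul_comm (b ^ n), ← hhead, ← htail]
    ring

theorem mul_vwpPsiTerm (hq0 : q ≠ 0) (hq : ‖q‖ < 1) {a : ℂ} (ha : a ≠ 0)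
    (ha_pole : ∀ k : ℤ, a ≠ q ^ (2 * k)) {as : List ℂ} (h0 : ∀ x ∈ as, x ≠ 0)
    (hU : ∀ x ∈ as, ∀ k : ℕ, x ≠ q ^ (k + 1)) (hL : ∀ x ∈ as, ∀ k : ℕ, a * q / x * q ^ k ≠ 1)
    (w : ℂ) (n : ℤ) :
    (1 - a) * (qInfs q (as.map (q / ·)) * qInfs q (as.map (a * q / ·))) * vwpPsiTerm q a as w n =
      (w * as.prod) ^ n * (1 - a * (q ^ n) ^ 2) * wpFactors q a (as.map (·⁻¹)) n := by
  obtain ⟨s, hs⟩ : ∃ s, s = a ^ (1 / 2 : ℂ) := ⟨_, rfl⟩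
  have hss : s * s = a := by
    rw [hs, ← Complex.cpow_add _ _ ha]
    norm_num
  have hs0 : s ≠ 0 := left_ne_zero_of_mul (hss ▸ ha)
  have hpole (t : ℂ) (ht : t * t = a) (n : ℤ) : t * q ^ n ≠ 1 := fun h => by
    refine ha_pole (-n) ?_
    rw [← ht, mul_comm 2, zpow_mul, zpow_neg, ← eq_inv_of_mul_eq_one_left h]
    exact (pow_two t).symm
  have ha₁ : 1 - a ≠ 0 := sub_ne_zero.2 (by simpa using (ha_pole 0).symm)
  have hlower : a * q / (q * s) = s := by
    rw [← hss]
    field_simp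
  have hratio : qPoch q (q * s) n * qPoch q (-(q * s)) n / (qPoch q s n * qPoch q (-s) n) =
      (1 - a * (q ^ n) ^ 2) / (1 - a) := by
    have hneg := qPoch_mul_div_qPoch hq0 (hpole (-s) (by rw [neg_mul_neg, hss])) n
    rw [mul_neg] at hneg
    rw [← div_mul_div_comm, qPoch_mul_div_qPoch hq0 (hpole s hss), hneg, div_mul_div_comm, ← hss]
    ring_nf
  calc _ = qPoch q (q * s) n * qPoch q (-(q * s)) n / (qPoch q s n * qPoch q (-s) n) * (1 - a) *
        (qPochs q as n / qPochs q (as.map (a * q / ·)) n *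
          (qInfs q (as.map (q / ·)) * qInfs q (as.map (a * q / ·)))) * w ^ n := by
        simp only [vwpPsiTerm, psiTerm, vwpUpper, qPochs, ← hs, List.map_cons, List.prod_cons,
          div_neg, hlower]
        ring
    _ = _ := by
        rw [hratio, div_mul_cancel₀ _ ha₁, qPochs_div_qPochs_eq_wpFactors hq0 hq h0 hU hL,
          mul_zpow]
        ring

theorem qInfs_ne_zero (hq : ‖q‖ < 1) {xs : List ℂ} (h : ∀ x ∈ xs, ∀ k : ℕ, x * q ^ k ≠ 1) :
    qInfs q xs ≠ 0 := by
  refine List.prod_ne_zero (mt List.mem_map.1 ?_)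
  rintro ⟨x, hx, hx0⟩
  exact qInf_ne_zero hq (h x hx) hx0

theorem qInfs_map_div_ne_zero (hq : ‖q‖ < 1) {as : List ℂ}
    (hU : ∀ x ∈ as, ∀ k : ℕ, x ≠ q ^ (k + 1)) : qInfs q (as.map (q / ·)) ≠ 0 :=
  qInfs_ne_zero hq <| List.forall_mem_map.2 fun x hx k h => hU x hx k <| by
    have hx0 : x ≠ 0 := by
      rintro rfl
      simp at h
    rw [div_mul_eq_mul_div, div_eq_one_iff_eq hx0, ← pow_succ'] at h
    exact h.symm

theorem div_add_sub_sub_eq {K : Type*} [Field K] {a d e z : K} (hde : d * e = a) (hz : z ≠ 0) :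
    a / z + z - d - e = z * ((1 - d / z) * (1 - e / z)) := by
  rw [← hde]
  field_simp
  ring

theorem div_add_ne_add {K : Type*} [Field K] {a d e z : K} (hde : d * e = a) (hz : z ≠ 0)
    (hd : d / z ≠ 1) (he : e / z ≠ 1) : a / z + z ≠ d + e := by
  rw [← sub_ne_zero, ← sub_sub, div_add_sub_sub_eq hde hz]
  exact mul_ne_zero hz (mul_ne_zero (sub_ne_zero.2 hd.symm) (sub_ne_zero.2 he.symm))

theorem mul_qInfs_eq_mul_Omega {a b c d e z : ℂ} (hq : ‖q‖ < 1) (hbc : b * c = z * q)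
    (hde : d * e = a) (hb : b ≠ 0) (hc : c ≠ 0) (hd : d ≠ 0) (he : e ≠ 0) (hz : z ≠ 0) :
    (a / z + z - d - e) * (qInfs q [q / b, q / c, q / d, q / e, q / (a / z), q / z] *
          qInfs q [a * q / b, a * q / c, a * q / d, a * q / e, a * q / (a / z), a * q / z]) *
        qInfs q [d / z * q, e / z * q] =
      z * qInfs q [q / d, q / e, z * q, a * q / z] * (qInfs q [q / z, z * q / a] *
        Omega q [1 / z] [1 / b, 1 / c, 1 / d, 1 / e] * Omega q [a * q] [b, c, d, e]) := by
  have ha : a ≠ 0 := hde ▸ mul_ne_zero hd he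
  have hqb : q / b = c / z := by
    rw [div_eq_div_iff hb hz]
    linear_combination -hbc
  have hqc : q / c = b / z := by
    rw [div_eq_div_iff hc hz]
    linear_combination -hbc
  have hay : a * q / (a / z) = z * q := by field_simp
  simp only [qInfs, Omega, List.map_cons, List.map_nil, List.prod_cons, List.prod_nil,
    div_div_eq_mul_div, one_div_mul_eq_div, div_one, hqb, hqc, mul_comm q z, hay,
    div_add_sub_sub_eq hde hz, qInf_eq_mul hq (d / z), qInf_eq_mul hq (e / z)]
  ring

theorem qInfs_mul_thetas_sub_eq {a b c d e z : ℂ} (hbc : b * c = z * q) (hde : d * e = a)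
    (hb : b ≠ 0) (hc : c ≠ 0) (hd : d ≠ 0) (he : e ≠ 0) :
    qInfs q [q, q, a * q, q / a] *
          (thetas q [d, e] * qInfs q [a / z * q / b, z * q / b, a / z * q / c, z * q / c] -
            thetas q [a / z, z] * qInfs q [d * q / b, e * q / b, d * q / c, e * q / c]) *
        qInfs q [d / z * q, e / z * q] =
      qInfs q [q, q, a * q, q / a, a * q / (d * z), a * q / (e * z)] *
        (thetas q [d, e] * qInfs q [b, c, a * q / (b * z), a * q / (c * z)] -
          thetas q [z, a / z] * qInfs q [a * q / (b * d), a * q / (b * e),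
            a * q / (c * d), a * q / (c * e)]) := by
  have hzb : z * q / b = c := by rw [← hbc, mul_div_cancel_left₀ c hb]
  have hzc : z * q / c = b := by rw [← hbc, mul_div_cancel_right₀ b hc]
  have hd' (x : ℂ) : a * q / (x * d) = e * q / x := by rw [← hde]; field_simp
  have he' (x : ℂ) : a * q / (x * e) = d * q / x := by rw [← hde]; field_simp
  have hz' (x : ℂ) : a / z * q / x = a * q / (x * z) := by
    rw [div_mul_eq_mul_div, div_div, mul_comm z]
  simp only [qInfs, thetas, List.map_cons, List.map_nil, List.prod_cons, List.prod_nil, hzb, hzc,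
    hz', mul_comm d z, mul_comm e z, hd', he', div_mul_eq_mul_div d, div_mul_eq_mul_div e]
  ring

end QSeries

end

open QSeries in
theorem mainTheorem9_general {q a b c d e y z : ℂ} (hq0 : q ≠ 0) (hq : ‖q‖ < 1)
    (hb : b ≠ 0) (hc : c ≠ 0) (hd : d ≠ 0) (he : e ≠ 0) (hde : d * e = a) (hyz : y * z = a)
    (hconv : ‖a * q ^ 2 / (b * c)‖ < 1) (hpairs : y + z ≠ d + e)
    (ha_pole : ∀ k : ℤ, a ≠ q ^ (2 * k))
    (h_upper : ∀ x ∈ [b, c, d, e, y, z], ∀ k : ℕ, x ≠ q ^ (k + 1))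
    (h_lower : ∀ x ∈ [b, c, d, e, y, z], ∀ k : ℕ, a * q / x * q ^ k ≠ 1) :
    HasSum (vwpPsiTerm q a [b, c, d, e, y, z] (a * q ^ 2 / (b * c)))
      (qInfs q [q, q, a * q, q / a] *
        (thetas q [d, e] * qInfs q [y * q / b, z * q / b, y * q / c, z * q / c] -
          thetas q [y, z] * qInfs q [d * q / b, e * q / b, d * q / c, e * q / c]) /
        ((y + z - d - e) * (qInfs q [q / b, q / c, q / d, q / e, q / y, q / z] *
          qInfs q [a * q / b, a * q / c, a * q / d, a * q / e, a * q / y, a * q / z]))) := by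
  have ha : a ≠ 0 := hde ▸ mul_ne_zero hd he
  have hy : y ≠ 0 := left_ne_zero_of_mul (hyz ▸ ha)
  have hz : z ≠ 0 := right_ne_zero_of_mul (hyz ▸ ha)
  have ha₁ : 1 - a ≠ 0 := sub_ne_zero.2 (by simpa using (ha_pole 0).symm)
  have hκ : y + z - d - e ≠ 0 := by rwa [sub_sub, sub_ne_zero]
  have h0 : ∀ x ∈ [b, c, d, e, y, z], x ≠ 0 := by simp [hb, hc, hd, he, hy, hz]
  have hQ := qInfs_map_div_ne_zero hq h_upper
  have hA : qInfs q ([b, c, d, e, y, z].map (a * q / ·)) ≠ 0 :=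
    qInfs_ne_zero hq (List.forall_mem_map.2 h_lower)
  have hprod : a * q ^ 2 / (b * c) * [b, c, d, e, y, z].prod = a ^ 3 * q ^ 2 := by
    simp only [List.prod_cons, List.prod_nil, mul_one, hyz, ← mul_assoc d e, hde]
    field_simp
  have hsum := hasSum_mul_eightPsiTerm hq0 hq hd he hy hz hde hyz (B := b⁻¹) (C := c⁻¹)
    (by rwa [← mul_inv])
  have hqa : qInfs q [q, q, a, q / a] = (1 - a) * qInfs q [q, q, a * q, q / a] := by
    simp only [qInfs, List.map_cons, List.prod_cons, qInf_eq_mul hq a]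
    ring
  have hcancel (X : ℂ) : (y + z - d - e) * ((1 - a) *
      (qInfs q ([b, c, d, e, y, z].map (q / ·)) * qInfs q ([b, c, d, e, y, z].map (a * q / ·))) *
      (X / ((y + z - d - e) * (qInfs q ([b, c, d, e, y, z].map (q / ·)) *
        qInfs q ([b, c, d, e, y, z].map (a * q / ·)))))) = (1 - a) * X := by
    field_simp
  rw [← hasSum_mul_left_iff (mul_ne_zero hκ (mul_ne_zero ha₁ (mul_ne_zero hQ hA)))]
  simp only [mul_assoc (y + z - d - e), mul_vwpPsiTerm hq0 hq ha ha_pole h0 h_upper h_lower, hprod]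
  refine (congrArg (HasSum _) ((hcancel _).trans ?_)).mpr hsum
  rw [hqa, mul_assoc]
  simp only [div_eq_mul_inv]

open QSeries in
theorem mainTheorem9 (q a b c d e z : ℂ)
    (hq0 : q ≠ 0) (hq1 : ‖q‖ < 1)
    (hb : b ≠ 0) (hc : c ≠ 0) (hd : d ≠ 0) (he : e ≠ 0)
    (ha : a = d * e) (hbc : b * c = z * q)
    -- the argument of the series
    (hconv : ‖a * q / z‖ < 1)
    -- no denominator in the terms of the series vanishes
    (ha_pole : ∀ k : ℤ, a ≠ q ^ (2 * k))
    (h_upper : ∀ x ∈ [b, c, d, e, a / z, z], ∀ k : ℕ, x ≠ q ^ (k + 1))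
    (h_lower : ∀ x ∈ [b, c, d, e, a / z, z], ∀ k : ℕ, a * q / x * q ^ k ≠ 1)
    -- the two remaining factors in the denominator of the product do not vanish
    (hdz : ∀ k : ℕ, d / z * q ^ k ≠ 1)
    (hez : ∀ k : ℕ, e / z * q ^ k ≠ 1) :
    Summable (QSeries.vwpPsiTerm q a [b, c, d, e, a / z, z] (a * q / z)) ∧
    QSeries.vwpPsi q a [b, c, d, e, a / z, z] (a * q / z) =
      QSeries.qInfs q [q, q, a * q, q / a, a * q / (d * z), a * q / (e * z)] *
        ((QSeries.thetas q [d, e] *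
              QSeries.qInfs q [b, c, a * q / (b * z), a * q / (c * z)] -
            QSeries.thetas q [z, a / z] *
              QSeries.qInfs q [a * q / (b * d), a * q / (b * e),
                a * q / (c * d), a * q / (c * e)]) /
          (z * QSeries.qInfs q [q / d, q / e, z * q, a * q / z])) /
        (QSeries.qInfs q [q / z, z * q / a] *
          QSeries.Omega q [1 / z] [1 / b, 1 / c, 1 / d, 1 / e] *
          QSeries.Omega q [a * q] [b, c, d, e]) := by
  have hz : z ≠ 0 := left_ne_zero_of_mul (hbc ▸ mul_ne_zero hb hc)
  have hw : a * q ^ 2 / (b * c) = a * q / z := by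
    rw [hbc]
    field_simp
  have hpairs : a / z + z ≠ d + e :=
    div_add_ne_add ha.symm hz (by simpa using hdz 0) (by simpa using hez 0)
  have hsum := mainTheorem9_general hq0 hq1 hb hc hd he ha.symm (div_mul_cancel₀ a hz)
    (hw ▸ hconv) hpairs ha_pole h_upper h_lower
  rw [hw] at hsum
  refine ⟨hsum.summable, hsum.tsum_eq.trans ?_⟩
  have hne : qInfs q [d / z * q, e / z * q] ≠ 0 := qInfs_ne_zero hq1 <| by
    simp [mul_assoc, ← pow_succ', hdz, hez]
  rw [← mul_div_mul_right _ _ hne, mul_qInfs_eq_mul_Omega hq1 hbc ha.symm hb hc hd he hz,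
    qInfs_mul_thetas_sub_eq hbc ha.symm hb hc hd he, mul_div_assoc', div_div]
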